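/- Let $p$ be a prime number. Let $\mathcal{L}(\mathbb{Z}_p)$ (the Cantor frame) be the frame generated by the elements $B_r(a)$, where $a\in\mathbb{Z}$ and $r\in|\mathbb{Z}|:=\{p^{-n+1}\mid n=1,2,3,\dots\}$, subject to the relations - $B_r(a)\wedge B_s(b)=0$ whenever $|a-b|_p\ge r$ and $s\le r$; - $1=\bigvee\{B_r(a)\mid a\in\mathbb{Z},\ r\in|\mathbb{Z}|\}$; - $B_r(a)=\bigvee\{B_s(b)\mid |a-b|_p<r,\ s<r,\ b\in\mathbb{Z},\ s\in|\mathbb{Z}|\}$. Let $L$ be a frame. Then $L$ is isomorphic to $\mathcal{L}(\mathbb{Z}_p)$ if and only if $L$ is nontrivial ($0\neq 1$), $0$-dimensional, compact and metrizable, and $\mathrm{cbd}_L(0)=0$. Here $L$ is $0$-dimensional if every $a\in L$ is the join of the complemented elements below $a$, compact if every $A\subseteq L$ with $\bigvee A=1$ has a finite subset with join $1$, and metrizable if it admits a uniformity with a countable basis. The Cantor–Bendixson derivative is $\mathrm{cbd}_L(a)=\bigwedge\{x\in L\mid a\le x\text{ and }(x\to a)=a\}$. A cover of $L$ is a subset with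 join $1$; a cover $A$ refines $B$ if each element of $A$ is below some element of $B$; $Ax=\bigvee\{a\in A\mid a\wedge x\neq 0\}$. A uniformity on $L$ is a nonempty set $\mathcal{U}$ of covers, closed under coarser covers and under binary common refinements $\{a\wedge b\mid a\in A,\ b\in B\}$, such that for each $A\in\mathcal{U}$ there is $B\in\mathcal{U}$ for which $\{Bb\mid b\in B\}$ refines $A$, and such that $x=\bigvee\{y\mid Ay\le x\text{ for some }A\in\mathcal{U}\}$ for all $x\in L$. A basis of $\mathcal{U}$ is a subset $\mathcal{B}\subseteq\mathcal{U}$ such that each member of $\mathcal{U}$ is refined by a member of $\mathcal{B}$. -/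

import Mathlib

/-! ### Frames presented by generators and relations -/

/-- The free frame on a set `G` of generators: the frame of down-sets of the free meet-semilattice
with top on `G`, that is, of the finite subsets of `G` ordered by reverse inclusion (the finite set
`s` stands for the formal meet of its elements). -/
abbrev FreeFrame (G : Type*) : Type _ := LowerSet (Finset G)ᵒᵈ

/-- The generator of the free frame given by `g`: the principal down-set of `{g}`. -/
def FreeFrame.gen {G : Type*} (g : G) : FreeFrame G := LowerSet.Iic (OrderDual.toDual {g})

/-- The elements `s` of `F` saturated for a relation `R` (`a ⊓ c ≤ s` if and only if `b ⊓ c ≤ s`,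
for all related `a`, `b` and all `c`) form a sublocale of `F`; as a frame it is the quotient of `F`
by the least frame congruence that contains `R`. -/
def Sublocale.saturated {F : Type*} [Order.Frame F] (R : F → F → Prop) : Sublocale F where
  carrier := {s | ∀ a b, R a b → ∀ c, a ⊓ c ≤ s ↔ b ⊓ c ≤ s}
  sInf_mem' := by
    intro S hS a b hab c
    simp only [le_sInf_iff]
    exact forall₂_congr fun s hs => hS hs a b hab c
  himp_mem' := by
    intro x s hs a b hab c
    rw [le_himp_iff, le_himp_iff, inf_assoc, inf_assoc]
    exact hs a b hab (c ⊓ x)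

/-- The frame generated by the elements of `G` subject to the relations `u = v` for all `u`, `v` in
the free frame on `G` with `R u v`. -/
abbrev PresentedFrame {G : Type*} (R : FreeFrame G → FreeFrame G → Prop) : Type _ :=
  ↥(Sublocale.saturated R)

/-! ### The Cantor frame -/

/-- The set of radii `{p ^ (-n + 1) | n = 1, 2, 3, …}`. -/
def cantorRadii (p : ℕ) : Set ℚ := {r | ∃ n : ℕ, 1 ≤ n ∧ r = (p : ℚ) ^ (-(n : ℤ) + 1)}

/-- The formal ball `B_r(a)` as a generator of the free frame on all pairs `(a, r)`. -/
def formalBall (p : ℕ) (a : ℤ) (r : cantorRadii p) : FreeFrame (ℤ × cantorRadii p) :=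
  FreeFrame.gen (a, r)

/-- The defining relations of the Cantor frame. -/
inductive CantorRel (p : ℕ) :
    FreeFrame (ℤ × cantorRadii p) → FreeFrame (ℤ × cantorRadii p) → Prop
  /-- `B_r(a) ∧ B_s(b) = 0` whenever `|a - b|_p ≥ r` and `s ≤ r`. -/
  | disjoint (a b : ℤ) (r s : cantorRadii p)
      (hab : (r : ℚ) ≤ padicNorm p ((a : ℚ) - (b : ℚ))) (hsr : (s : ℚ) ≤ (r : ℚ)) :
      CantorRel p (formalBall p a r ⊓ formalBall p b s) ⊥
  /-- `1` is the join of all `B_r(a)`. -/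
  | cover : CantorRel p ⊤ (sSup {x | ∃ (a : ℤ) (r : cantorRadii p), x = formalBall p a r})
  /-- `B_r(a)` is the join of all `B_s(b)` with `|a - b|_p < r` and `s < r`. -/
  | interior (a : ℤ) (r : cantorRadii p) :
      CantorRel p (formalBall p a r)
        (sSup {x | ∃ (b : ℤ) (s : cantorRadii p),
          padicNorm p ((a : ℚ) - (b : ℚ)) < (r : ℚ) ∧ (s : ℚ) < (r : ℚ) ∧ x = formalBall p b s})

/-- The Cantor frame `L(ℤ_p)`: the frame generated by the formal balls `B_r(a)`, with `a ∈ ℤ` and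
`r` a radius, subject to the relations `CantorRel p`. -/
abbrev CantorFrame (p : ℕ) : Type := PresentedFrame (CantorRel p)

/-! ### Properties of frames -/

/-- A frame is `0`-dimensional if every element is the join of the complemented elements
below it. -/
def IsZeroDimensionalFrame (L : Type*) [Order.Frame L] : Prop :=
  ∀ a : L, a = sSup {b | b ≤ a ∧ IsComplemented b}

/-- A frame is compact if its top element is compact (every cover has a finite subcover). -/
def IsCompactFrame (L : Type*) [Order.Frame L] : Prop := IsCompactElement (⊤ : L)

/-- The Cantor–Bendixson derivative of a frame. -/
def cbd {L : Type*} [Order.Frame L] (a : L) : L := sInf {x | a ≤ x ∧ (x ⇨ a) = a}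

/-! ### Uniformities on frames -/

/-- A cover of a frame is a subset with join `1`. -/
def IsFrameCover {L : Type*} [Order.Frame L] (A : Set L) : Prop := sSup A = ⊤

/-- `A` refines `B`: every element of `A` lies below an element of `B`. -/
def CoverRefines {L : Type*} [Order.Frame L] (A B : Set L) : Prop := ∀ a ∈ A, ∃ b ∈ B, a ≤ b

/-- The star `A x` of `x` in `A`: the join of the members of `A` that meet `x`. -/
def coverStar {L : Type*} [Order.Frame L] (A : Set L) (x : L) : L :=
  sSup {a | a ∈ A ∧ a ⊓ x ≠ ⊥}

/-- A uniformity on a frame `L`: a filter of covers with respect to refinement, in which every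
member has a star-refinement, and which is admissible, i.e. every `x` is the join of the elements
uniformly below it. -/
structure FrameUniformity (L : Type*) [Order.Frame L] where
  /-- The uniform covers. -/
  covers : Set (Set L)
  isCover : ∀ A ∈ covers, IsFrameCover A
  nonempty : covers.Nonempty
  upward : ∀ A ∈ covers, ∀ B, IsFrameCover B → CoverRefines A B → B ∈ covers
  inf_mem : ∀ A ∈ covers, ∀ B ∈ covers, {x | ∃ a ∈ A, ∃ b ∈ B, x = a ⊓ b} ∈ covers
  star_refine : ∀ A ∈ covers, ∃ B ∈ covers, CoverRefines {x | ∃ b ∈ B, x = coverStar B b} A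
  admissible : ∀ x : L, x = sSup {y | ∃ A ∈ covers, coverStar A y ≤ x}

/-- A uniformity is countably generated if it has a countable basis. -/
def FrameUniformity.IsCountablyGenerated {L : Type*} [Order.Frame L]
    (U : FrameUniformity L) : Prop :=
  ∃ B : Set (Set L), B.Countable ∧ B ⊆ U.covers ∧ ∀ A ∈ U.covers, ∃ C ∈ B, CoverRefines C A

/-- A frame is metrizable if it admits a countably generated uniformity. -/
def IsMetrizableFrame (L : Type*) [Order.Frame L] : Prop :=
  ∃ U : FrameUniformity L, U.IsCountablyGenerated

/-! ### Uniqueness: back and forth between partitions of unity -/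

/-! The heart is Cantor's back-and-forth argument, run on finite partitions of unity. In a compact
frame each complemented element is decided by a uniform cover, so it is a finite join from a finite
subcover of a basic cover; hence metrizability leaves only countably many
(`countable_isComplemented`). In a zero-dimensional frame, a complemented atom would lie below every
dense element, which `cbd ⊥ = ⊥` forbids (`isAtomlessFrame_of_cbd_bot`).

For two such frames, matched partitions can be refined until any given complemented element on
either side is decided (`IsPartIso.exists_refines_deciding`). A directed family of matched
partitions deciding all of them generates both frames, and compactness carries coverings across
(`le_sSup_image_of_directed`); this gives the isomorphism `nonempty_orderIso_of_countable_atomless`.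

It remains to see that the Cantor frame has the listed properties, which then transport along
isomorphisms. Balls of a fixed radius partition unity, giving zero-dimensionality and metrizability.
Each ball splits into `p` smaller ones, giving compactness. Each integer is a point, so balls are
nonzero, and removing a point leaves a dense element; no ball lies below all of these. -/

/-- A frame is atomless if every nonzero complemented element splits into two nonzero complemented
elements. -/
def IsAtomlessFrame (L : Type*) [Order.Frame L] : Prop :=
  ∀ c : L, IsComplemented c → c ≠ ⊥ → ∃ c₁ c₂ : L, IsComplemented c₁ ∧ IsComplemented c₂ ∧
    c₁ ≠ ⊥ ∧ c₂ ≠ ⊥ ∧ Disjoint c₁ c₂ ∧ c₁ ⊔ c₂ = c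

/-- A finite set `P` whose images under `u` and `v` are partitions of unity into nonzero
complemented elements: a finite partial isomorphism between two frames. -/
structure IsPartIso {α L L' : Type*} [Order.Frame L] [Order.Frame L'] (u : α → L) (v : α → L')
    (P : Finset α) : Prop where
  compl_left : ∀ e ∈ P, IsComplemented (u e)
  compl_right : ∀ e ∈ P, IsComplemented (v e)
  ne_left : ∀ e ∈ P, u e ≠ ⊥
  ne_right : ∀ e ∈ P, v e ≠ ⊥
  disj_left : ∀ e ∈ P, ∀ e' ∈ P, e ≠ e' → Disjoint (u e) (u e')
  disj_right : ∀ e ∈ P, ∀ e' ∈ P, e ≠ e' → Disjoint (v e) (v e')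
  sup_left : P.sup u = ⊤
  sup_right : P.sup v = ⊤

/-- `Q` refines `P` in both coordinates. -/
def PartIsoRefines {α L L' : Type*} [Order.Frame L] [Order.Frame L'] (u : α → L) (v : α → L')
    (P Q : Finset α) : Prop :=
  ∀ q ∈ Q, ∃ p ∈ P, u q ≤ u p ∧ v q ≤ v p

section PartIso

variable {α L L' : Type*} [Order.Frame L] [Order.Frame L'] {u : α → L} {v : α → L'}
  {P Q R : Finset α}

theorem IsPartIso.swap (h : IsPartIso u v P) : IsPartIso v u P :=
  ⟨h.compl_right, h.compl_left, h.ne_right, h.ne_left, h.disj_right, h.disj_left, h.sup_right,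
    h.sup_left⟩

theorem PartIsoRefines.swap (h : PartIsoRefines u v P Q) : PartIsoRefines v u P Q := fun q hq =>
  let ⟨p, hp, h₁, h₂⟩ := h q hq
  ⟨p, hp, h₂, h₁⟩

theorem PartIsoRefines.refl (P : Finset α) : PartIsoRefines u v P P :=
  fun q hq => ⟨q, hq, le_rfl, le_rfl⟩

theorem PartIsoRefines.trans (h : PartIsoRefines u v P Q) (h' : PartIsoRefines u v Q R) :
    PartIsoRefines u v P R := fun r hr =>
  let ⟨q, hq, h₁, h₂⟩ := h' r hr
  let ⟨p, hp, h₃, h₄⟩ := h q hq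
  ⟨p, hp, h₁.trans h₃, h₂.trans h₄⟩

/-- Parts of `P` are disjoint, so a part of `Q` can meet only the one that contains it. Meeting in
one coordinate thus yields containment in both. -/
theorem IsPartIso.le_of_not_disjoint (hP : IsPartIso u v P) (h : PartIsoRefines u v P Q)
    {p q : α} (hp : p ∈ P) (hq : q ∈ Q) (hpq : ¬ Disjoint (u q) (u p)) :
    u q ≤ u p ∧ v q ≤ v p := by
  obtain ⟨p', hp', h₁, h₂⟩ := h q hq
  rcases eq_or_ne p' p with rfl | hne
  · exact ⟨h₁, h₂⟩
  · exact absurd ((hP.disj_left p' hp' p hp hne).mono_left h₁) hpq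

/-- Distributivity writes `x` as the join of its meets with the cover; members disjoint from `x`
contribute nothing. -/
theorem le_sSup_of_forall_le {P : Finset α} (hP : P.sup u = ⊤) {x y : L}
    (h : ∀ e ∈ P, ¬ Disjoint (u e) x → u e ≤ y) : x ≤ y := by
  have hx : x = P.sup fun e => x ⊓ u e := by
    rw [← Finset.sup_inf_distrib_left, hP, inf_top_eq]
  rw [hx]
  refine Finset.sup_le fun e he => ?_
  by_cases hd : Disjoint (u e) x
  · rw [hd.symm.eq_bot]
    exact bot_le
  · exact inf_le_right.trans (h e he hd)

/-- Adjoining the complement of `b` turns a cover of `b` into a cover of `⊤`. -/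
theorem IsComplemented.exists_finset_of_le_sSup {L : Type*} [Order.Frame L]
    (hL : IsCompactFrame L) {b : L} (hb : IsComplemented b) {S : Set L} (h : b ≤ sSup S) :
    ∃ T : Finset L, ↑T ⊆ S ∧ b ≤ T.sup id := by
  classical
  obtain ⟨c, hc⟩ := hb
  have htop : ⊤ ≤ sSup (insert c S) := by
    rw [sSup_insert, ← hc.sup_eq_top, sup_comm]
    exact sup_le_sup_left h c
  obtain ⟨T, hT, hle⟩ :=
    (CompleteLattice.isCompactElement_iff_exists_le_sSup_of_le_sSup L ⊤).1 hL _ htop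
  refine ⟨T.erase c, fun x hx => ?_, ?_⟩
  · rw [Finset.mem_coe, Finset.mem_erase] at hx
    exact (hT hx.2).resolve_left hx.1
  · have h₁ : b ≤ c ⊔ (T.erase c).sup id := by
      refine le_top.trans (hle.trans (Finset.sup_le fun x hx => ?_))
      rcases eq_or_ne x c with rfl | hne
      · exact le_sup_left
      · exact (Finset.le_sup (f := id) (Finset.mem_erase.2 ⟨hne, hx⟩)).trans le_sup_right
    exact hc.disjoint.left_le_of_le_sup_left h₁

/-- In a directed family of partial isomorphisms, a covering in one coordinate is a covering in the
other. -/
theorem le_sSup_image_of_directed (hL' : IsCompactFrame L') {𝓕 : Set (Finset α)}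
    (h𝓕 : ∀ P ∈ 𝓕, IsPartIso u v P) (hdir : DirectedOn (PartIsoRefines u v) 𝓕)
    {P : Finset α} (hP : P ∈ 𝓕) {e : α} (he : e ∈ P) {S : Set α}
    (hS : ∀ s ∈ S, ∃ P ∈ 𝓕, s ∈ P) (h : v e ≤ sSup (v '' S)) : u e ≤ sSup (u '' S) := by
  classical
  obtain ⟨T, hT, hle⟩ := ((h𝓕 P hP).compl_right e he).exists_finset_of_le_sSup hL' h
  obtain ⟨T', hT', rfl⟩ := Finset.subset_set_image_iff.1 hT
  -- The finitely many parts in `T'` may come from different partitions; directedness supplies one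
  -- refining all of them together with `P`.
  have hQ : ∃ Q ∈ 𝓕, PartIsoRefines u v P Q ∧
      ∀ t ∈ T', ∃ P' ∈ 𝓕, t ∈ P' ∧ PartIsoRefines u v P' Q := by
    clear hle hT
    induction T' using Finset.induction_on with
    | empty => exact ⟨P, hP, .refl _, by simp⟩
    | insert t T' _ ih =>
      rw [Finset.coe_insert, Set.insert_subset_iff] at hT'
      obtain ⟨Q, hQ, hPQ, hQT⟩ := ih hT'.2
      obtain ⟨P', hP', htP'⟩ := hS t hT'.1
      obtain ⟨Q', hQ', h₁, h₂⟩ := hdir Q hQ P' hP'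
      refine ⟨Q', hQ', hPQ.trans h₁, fun s hs => ?_⟩
      rcases Finset.mem_insert.1 hs with rfl | hs
      · exact ⟨P', hP', htP', h₂⟩
      · obtain ⟨P'', h₃, h₄, h₅⟩ := hQT s hs
        exact ⟨P'', h₃, h₄, h₅.trans h₁⟩
  obtain ⟨Q, hQ, hPQ, hQT⟩ := hQ
  refine le_sSup_of_forall_le (h𝓕 Q hQ).sup_left fun q hq hd => ?_
  have hqe := (h𝓕 P hP).le_of_not_disjoint hPQ he hq hd
  -- `v q` is nonzero and lies below the join of the `v t`, so it meets one of them; that places `q`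
  -- under `t` in both coordinates.
  have hex : ∃ t ∈ T', ¬ Disjoint (v q) (v t) := by
    by_contra! hcon
    refine (h𝓕 Q hQ).ne_right q hq ?_
    have h₁ : Disjoint (v q) ((T'.image v).sup id) := by
      rw [Finset.disjoint_sup_right]
      intro x hx
      obtain ⟨t, ht, rfl⟩ := Finset.mem_image.1 hx
      exact hcon t ht
    exact h₁.eq_bot_of_le (hqe.2.trans hle)
  obtain ⟨t, ht, hqt⟩ := hex
  obtain ⟨P', hP', htP', hr⟩ := hQT t ht
  exact ((h𝓕 P' hP').swap.le_of_not_disjoint hr.swap htP' hq hqt).2.trans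
    (le_sSup ⟨t, hT' ht, rfl⟩)

/-- The extension step of the back-and-forth argument. -/
theorem IsPartIso.exists_refines_deciding (hL' : IsAtomlessFrame L')
    (hsurj : ∀ x y, ∃ e, u e = x ∧ v e = y) (hP : IsPartIso u v P) {x : L}
    (hx : IsComplemented x) :
    ∃ Q, IsPartIso u v Q ∧ PartIsoRefines u v P Q ∧ ∀ q ∈ Q, u q ≤ x ∨ Disjoint (u q) x := by
  classical
  have hN : ∀ e ∈ P, ∃ N : Finset α,
      (∀ q ∈ N, IsComplemented (u q) ∧ IsComplemented (v q) ∧ u q ≠ ⊥ ∧ v q ≠ ⊥ ∧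
        (u q ≤ x ∨ Disjoint (u q) x)) ∧
      (∀ q ∈ N, ∀ q' ∈ N, q ≠ q' → Disjoint (u q) (u q') ∧ Disjoint (v q) (v q')) ∧
      N.sup u = u e ∧ N.sup v = v e := by
    intro e he
    by_cases hdec : u e ≤ x ∨ Disjoint (u e) x
    · refine ⟨{e}, ?_, ?_, by simp, by simp⟩
      · simp only [Finset.mem_singleton, forall_eq]
        exact ⟨hP.compl_left e he, hP.compl_right e he, hP.ne_left e he, hP.ne_right e he, hdec⟩
      · simp
    -- Here `x` cuts `u e` into two nonzero pieces. Any splitting of `v e` into nonzero complemented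
    -- pieces can be matched with them, and atomlessness provides one.
    · push Not at hdec
      obtain ⟨x', hxx'⟩ := hx
      obtain ⟨c₁, c₂, hc₁, hc₂, hn₁, hn₂, hd, hs⟩ := hL' _ (hP.compl_right e he) (hP.ne_right e he)
      obtain ⟨e₁, h₁, h₁'⟩ := hsurj (u e ⊓ x) c₁
      obtain ⟨e₂, h₂, h₂'⟩ := hsurj (u e ⊓ x') c₂
      have hdu : Disjoint (u e₁) (u e₂) := by
        rw [h₁, h₂]
        exact hxx'.disjoint.mono inf_le_right inf_le_right
      have hdv : Disjoint (v e₁) (v e₂) := by rwa [h₁', h₂']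
      refine ⟨{e₁, e₂}, ?_, ?_, ?_, ?_⟩
      · intro q hq
        rcases Finset.mem_insert.1 hq with rfl | hq
        · rw [h₁, h₁']
          exact ⟨(hP.compl_left e he).inf ⟨x', hxx'⟩, hc₁,
            fun h => hdec.2 (disjoint_iff.2 h), hn₁, Or.inl inf_le_right⟩
        · rw [Finset.mem_singleton.1 hq, h₂, h₂']
          exact ⟨(hP.compl_left e he).inf ⟨x, hxx'.symm⟩, hc₂,
            fun h => hdec.1 (hxx'.symm.disjoint_left_iff.1 (disjoint_iff.2 h)), hn₂,
            Or.inr (hxx'.symm.disjoint.mono_left inf_le_right)⟩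
      · intro q hq q' hq' hne
        simp only [Finset.mem_insert, Finset.mem_singleton] at hq hq'
        rcases hq with rfl | rfl <;> rcases hq' with rfl | rfl
        · exact absurd rfl hne
        · exact ⟨hdu, hdv⟩
        · exact ⟨hdu.symm, hdv.symm⟩
        · exact absurd rfl hne
      · rw [Finset.sup_insert, Finset.sup_singleton, h₁, h₂, ← inf_sup_left, hxx'.sup_eq_top,
          inf_top_eq]
      · rw [Finset.sup_insert, Finset.sup_singleton, h₁', h₂', hs]
  choose! N hN₁ hN₂ hN₃ hN₄ using hN
  have hle : ∀ e ∈ P, ∀ q ∈ N e, u q ≤ u e ∧ v q ≤ v e := fun e he q hq =>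
    ⟨hN₃ e he ▸ Finset.le_sup hq, hN₄ e he ▸ Finset.le_sup hq⟩
  have hdisj : ∀ q ∈ P.biUnion N, ∀ q' ∈ P.biUnion N, q ≠ q' →
      Disjoint (u q) (u q') ∧ Disjoint (v q) (v q') := by
    intro q hq q' hq' hne
    obtain ⟨e, he, hqe⟩ := Finset.mem_biUnion.1 hq
    obtain ⟨e', he', hqe'⟩ := Finset.mem_biUnion.1 hq'
    rcases eq_or_ne e e' with rfl | hee
    · exact hN₂ e he q hqe q' hqe' hne
    · exact ⟨(hP.disj_left e he e' he' hee).mono (hle e he q hqe).1 (hle e' he' q' hqe').1,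
        (hP.disj_right e he e' he' hee).mono (hle e he q hqe).2 (hle e' he' q' hqe').2⟩
  have hmem : ∀ q ∈ P.biUnion N, _ := fun q hq =>
    let ⟨e, he, hqe⟩ := Finset.mem_biUnion.1 hq
    hN₁ e he q hqe
  refine ⟨P.biUnion N, ⟨fun q hq => (hmem q hq).1, fun q hq => (hmem q hq).2.1,
    fun q hq => (hmem q hq).2.2.1, fun q hq => (hmem q hq).2.2.2.1,
    fun q hq q' hq' h => (hdisj q hq q' hq' h).1, fun q hq q' hq' h => (hdisj q hq q' hq' h).2,
    ?_, ?_⟩, fun q hq => ?_, fun q hq => (hmem q hq).2.2.2.2⟩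
  · rw [Finset.sup_biUnion, ← hP.sup_left]
    exact Finset.sup_congr rfl hN₃
  · rw [Finset.sup_biUnion, ← hP.sup_right]
    exact Finset.sup_congr rfl hN₄
  · obtain ⟨e, he, hqe⟩ := Finset.mem_biUnion.1 hq
    exact ⟨e, he, hle e he q hqe⟩

/-- If every complemented element is decided by a member of the family, then the family generates
the frame. -/
theorem eq_sSup_of_deciding (hL : IsZeroDimensionalFrame L) {𝓕 : Set (Finset α)}
    (h𝓕 : ∀ P ∈ 𝓕, IsPartIso u v P)
    (hdec : ∀ x : L, IsComplemented x → ∃ P ∈ 𝓕, ∀ q ∈ P, u q ≤ x ∨ Disjoint (u q) x) (x : L) :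
    x = sSup (u '' {e | (∃ P ∈ 𝓕, e ∈ P) ∧ u e ≤ x}) := by
  apply le_antisymm
  · conv_lhs => rw [hL x]
    refine sSup_le fun b ⟨hbx, hb⟩ => ?_
    obtain ⟨P, hP, hPb⟩ := hdec b hb
    refine le_sSup_of_forall_le (h𝓕 P hP).sup_left fun e he hd => ?_
    exact le_sSup ⟨e, ⟨⟨P, hP, he⟩, ((hPb e he).resolve_right hd).trans hbx⟩, rfl⟩
  · refine sSup_le ?_
    rintro _ ⟨e, he, rfl⟩
    exact he.2

end PartIso

/-- The finite partial isomorphisms between two frames. -/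
def PartIso (L L' : Type*) [Order.Frame L] [Order.Frame L'] : Type _ :=
  {P : Finset (L × L') // IsPartIso Prod.fst Prod.snd P}

instance PartIso.instPreorder (L L' : Type*) [Order.Frame L] [Order.Frame L'] :
    Preorder (PartIso L L') where
  le P Q := PartIsoRefines Prod.fst Prod.snd P.1 Q.1
  le_refl P := .refl P.1
  le_trans _ _ _ h h' := h.trans h'

/-- The partial isomorphism between the trivial partitions of unity. -/
def PartIso.trivial (L L' : Type*) [Order.Frame L] [Order.Frame L'] [Nontrivial L]
    [Nontrivial L'] : PartIso L L' :=
  ⟨{(⊤, ⊤)}, by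
    constructor <;> simp [isComplemented_top]⟩

/-- Nontrivial compact zero-dimensional atomless frames with countably many complemented elements
are isomorphic. -/
theorem nonempty_orderIso_of_countable_atomless {L L' : Type*} [Order.Frame L] [Order.Frame L']
    [Nontrivial L] [Nontrivial L']
    (hz : IsZeroDimensionalFrame L) (hz' : IsZeroDimensionalFrame L')
    (hc : IsCompactFrame L) (hc' : IsCompactFrame L')
    (hcount : {x : L | IsComplemented x}.Countable)
    (hcount' : {x : L' | IsComplemented x}.Countable)
    (ha : IsAtomlessFrame L) (ha' : IsAtomlessFrame L') : Nonempty (L ≃o L') := by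
  have := hcount.to_subtype
  have := hcount'.to_subtype
  let _ := Encodable.ofCountable {x : L | IsComplemented x}
  let _ := Encodable.ofCountable {x : L' | IsComplemented x}
  -- One cofinal set for each complemented element of either frame; by countability a single ideal
  -- meets them all.
  let 𝒟 : {x : L | IsComplemented x} ⊕ {x : L' | IsComplemented x} →
      Order.Cofinal (PartIso L L') := Sum.elim
    (fun x => ⟨{P | ∀ q ∈ P.1, q.1 ≤ x.1 ∨ Disjoint q.1 x.1}, fun P => by
      obtain ⟨Q, h₁, h₂, h₃⟩ := P.2.exists_refines_deciding ha' (fun x y => ⟨(x, y), rfl, rfl⟩) x.2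
      exact ⟨⟨Q, h₁⟩, h₃, h₂⟩⟩)
    (fun y => ⟨{P | ∀ q ∈ P.1, q.2 ≤ y.1 ∨ Disjoint q.2 y.1}, fun P => by
      obtain ⟨Q, h₁, h₂, h₃⟩ :=
        P.2.swap.exists_refines_deciding ha (fun x y => ⟨(y, x), rfl, rfl⟩) y.2
      exact ⟨⟨Q, h₁.swap⟩, h₃, h₂.swap⟩⟩)
  let I := Order.idealOfCofinals (PartIso.trivial L L') 𝒟
  let 𝓕 : Set (Finset (L × L')) :=
    {P | ∃ h : IsPartIso Prod.fst Prod.snd P, (⟨P, h⟩ : PartIso L L') ∈ I}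
  have h𝓕 : ∀ P ∈ 𝓕, IsPartIso Prod.fst Prod.snd P := fun P ⟨h, _⟩ => h
  have hdir : DirectedOn (PartIsoRefines Prod.fst Prod.snd) 𝓕 := by
    rintro P ⟨h, hP⟩ Q ⟨h', hQ⟩
    obtain ⟨R, hR, h₁, h₂⟩ := I.directed _ hP _ hQ
    exact ⟨R.1, ⟨R.2, hR⟩, h₁, h₂⟩
  have hdir' : DirectedOn (PartIsoRefines Prod.snd Prod.fst) 𝓕 := fun P hP Q hQ =>
    let ⟨R, hR, h₁, h₂⟩ := hdir P hP Q hQ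
    ⟨R, hR, h₁.swap, h₂.swap⟩
  have hdec : ∀ x : L, IsComplemented x → ∃ P ∈ 𝓕, ∀ q ∈ P, q.1 ≤ x ∨ Disjoint q.1 x := by
    intro x hx
    obtain ⟨P, hP, hPI⟩ := Order.cofinal_meets_idealOfCofinals (PartIso.trivial L L') 𝒟
      (Sum.inl ⟨x, hx⟩)
    exact ⟨P.1, ⟨P.2, hPI⟩, hP⟩
  have hdec' : ∀ x : L', IsComplemented x → ∃ P ∈ 𝓕, ∀ q ∈ P, q.2 ≤ x ∨ Disjoint q.2 x := by
    intro x hx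
    obtain ⟨P, hP, hPI⟩ := Order.cofinal_meets_idealOfCofinals (PartIso.trivial L L') 𝒟
      (Sum.inr ⟨x, hx⟩)
    exact ⟨P.1, ⟨P.2, hPI⟩, hP⟩
  have hgen := eq_sSup_of_deciding hz h𝓕 hdec
  have hgen' := eq_sSup_of_deciding hz' (fun P hP => (h𝓕 P hP).swap) hdec'
  let f : L → L' := fun x => sSup (Prod.snd '' {e : L × L' | (∃ P ∈ 𝓕, e ∈ P) ∧ e.1 ≤ x})
  let g : L' → L := fun y => sSup (Prod.fst '' {e : L × L' | (∃ P ∈ 𝓕, e ∈ P) ∧ e.2 ≤ y})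
  have hfm : Monotone f := fun x y hxy =>
    sSup_le_sSup (Set.image_mono fun e he => ⟨he.1, he.2.trans hxy⟩)
  have hgm : Monotone g := fun x y hxy =>
    sSup_le_sSup (Set.image_mono fun e he => ⟨he.1, he.2.trans hxy⟩)
  have hgf : ∀ x, g (f x) = x := by
    intro x
    conv_rhs => rw [hgen x]
    -- For pairs `e` in the family, `e.2 ≤ f x` is equivalent to `e.1 ≤ x`, so both sides are joins
    -- over the same set.
    refine congrArg (fun S => sSup (Prod.fst '' S)) (Set.ext fun e => and_congr_right ?_)
    rintro ⟨P, hP, he⟩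
    refine ⟨fun h => ?_, fun h => le_sSup ⟨e, ⟨⟨P, hP, he⟩, h⟩, rfl⟩⟩
    rw [hgen x]
    exact le_sSup_image_of_directed hc' h𝓕 hdir hP he (fun s hs => hs.1) h
  have hfg : ∀ y, f (g y) = y := by
    intro y
    conv_rhs => rw [hgen' y]
    refine congrArg (fun S => sSup (Prod.snd '' S)) (Set.ext fun e => and_congr_right ?_)
    rintro ⟨P, hP, he⟩
    refine ⟨fun h => ?_, fun h => le_sSup ⟨e, ⟨⟨P, hP, he⟩, h⟩, rfl⟩⟩
    rw [hgen' y]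
    exact le_sSup_image_of_directed hc (fun P hP => (h𝓕 P hP).swap) hdir' hP he (fun s hs => hs.1) h
  exact ⟨Equiv.toOrderIso ⟨f, g, hgf, hfg⟩ hfm hgm⟩

/-! ### Complemented elements of compact metrizable frames -/

section Frame

variable {L : Type*} [Order.Frame L]

theorem IsFrameCover.le_of_forall {A : Set L} (hA : IsFrameCover A) {x y : L}
    (h : ∀ a ∈ A, a ⊓ x ≠ ⊥ → a ≤ y) : x ≤ y := by
  have hx : x = ⨆ a ∈ A, a ⊓ x := by rw [← sSup_inf_eq, hA, top_inf_eq]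
  rw [hx]
  refine iSup₂_le fun a ha => ?_
  by_cases hd : a ⊓ x = ⊥
  · rw [hd]
    exact bot_le
  · exact inf_le_left.trans (h a ha hd)

theorem IsFrameCover.le_coverStar {A : Set L} (hA : IsFrameCover A) (x : L) : x ≤ coverStar A x :=
  hA.le_of_forall fun _ ha hd => le_sSup ⟨ha, hd⟩

theorem CoverRefines.isFrameCover {A B : Set L} (h : CoverRefines A B) (hA : IsFrameCover A) :
    IsFrameCover B := by
  refine top_le_iff.1 (hA.ge.trans (sSup_le fun a ha => ?_))
  obtain ⟨b, hb, hab⟩ := h a ha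
  exact hab.trans (le_sSup hb)

theorem CoverRefines.coverStar_le {A B : Set L} (h : CoverRefines A B) (x : L) :
    coverStar A x ≤ coverStar B x := by
  refine sSup_le fun a ⟨ha, hax⟩ => ?_
  obtain ⟨b, hb, hab⟩ := h a ha
  exact hab.trans (le_sSup ⟨hb, fun h0 => hax (le_bot_iff.1 ((inf_le_inf_right x hab).trans h0.le))⟩)

/-- In a compact frame, every complemented element is decided by a uniform cover. -/
theorem FrameUniformity.exists_cover_deciding (U : FrameUniformity L) (hL : IsCompactFrame L)
    {b : L} (hb : IsComplemented b) : ∃ A ∈ U.covers, ∀ a ∈ A, a ⊓ b ≠ ⊥ → a ≤ b := by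
  classical
  obtain ⟨T, hT, hle⟩ := hb.exists_finset_of_le_sSup hL (U.admissible b).le
  -- Each `t` has its own uniform cover; a common refinement serves all of the finite set `T`.
  have hA : ∃ A ∈ U.covers, ∀ t ∈ T, coverStar A t ≤ b := by
    clear hle
    induction T using Finset.induction_on with
    | empty =>
      obtain ⟨A, hA⟩ := U.nonempty
      exact ⟨A, hA, by simp⟩
    | insert t T _ ih =>
      rw [Finset.coe_insert, Set.insert_subset_iff] at hT
      obtain ⟨A, hA, hAT⟩ := ih hT.2
      obtain ⟨B, hB, hBt⟩ := hT.1
      refine ⟨_, U.inf_mem A hA B hB, fun s hs => ?_⟩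
      rcases Finset.mem_insert.1 hs with rfl | hs
      · refine (CoverRefines.coverStar_le ?_ s).trans hBt
        rintro _ ⟨a, -, c, hc, rfl⟩
        exact ⟨c, hc, inf_le_right⟩
      · refine (CoverRefines.coverStar_le ?_ s).trans (hAT s hs)
        rintro _ ⟨a, ha, c, -, rfl⟩
        exact ⟨a, ha, inf_le_left⟩
  obtain ⟨A, hA, hAT⟩ := hA
  refine ⟨A, hA, fun a ha hab => ?_⟩
  have hex : ∃ t ∈ T, a ⊓ t ≠ ⊥ := by
    by_contra! hcon
    have h₁ : Disjoint a (T.sup id) :=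
      Finset.disjoint_sup_right.2 fun t ht => disjoint_iff.2 (hcon t ht)
    exact hab (h₁.mono_right hle).eq_bot
  obtain ⟨t, ht, hat⟩ := hex
  have hle : a ≤ coverStar A t := le_sSup ⟨ha, hat⟩
  exact hle.trans (hAT t ht)

theorem countable_isComplemented (hL : IsCompactFrame L) (hm : IsMetrizableFrame L) :
    {x : L | IsComplemented x}.Countable := by
  classical
  obtain ⟨U, B, hB, hBU, hbase⟩ := hm
  have hF : ∀ C ∈ B, ∃ F : Finset L, ↑F ⊆ C ∧ ⊤ ≤ F.sup id := fun C hC =>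
    (CompleteLattice.isCompactElement_iff_exists_le_sSup_of_le_sSup L ⊤).1 hL C
      (U.isCover C (hBU hC)).ge
  choose! F hFC hFt using hF
  -- A complemented element is determined by a basic cover and a subset of its chosen finite
  -- subcover.
  refine (hB.biUnion fun C _ =>
    (((F C).powerset.finite_toSet).image fun T => T.sup id).countable).mono fun b hb => ?_
  obtain ⟨A, hA, hAb⟩ := U.exists_cover_deciding hL hb
  obtain ⟨C, hC, hCA⟩ := hbase A hA
  refine Set.mem_biUnion hC ⟨(F C).filter (· ≤ b), Finset.mem_coe.2 (Finset.mem_powerset.2 (Finset.filter_subset _ _)), ?_⟩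
  refine le_antisymm (Finset.sup_le fun c hc => (Finset.mem_filter.1 hc).2) ?_
  refine le_sSup_of_forall_le (u := id) (top_le_iff.1 (hFt C hC)) fun c hc hd => ?_
  obtain ⟨a, ha, hca⟩ := hCA c (hFC C hC hc)
  have hab : a ⊓ b ≠ ⊥ := fun h => hd ((disjoint_iff.2 h).mono_left hca)
  exact Finset.le_sup (f := id) (Finset.mem_filter.2 ⟨hc, hca.trans (hAb a ha hab)⟩)

/-- If `c` had no smaller nonzero complemented element, then any dense `x` would meet `c`, hence
contain a nonzero complemented part of `c`, hence `c` itself. So `c` would lie below `cbd ⊥`. -/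
theorem isAtomlessFrame_of_cbd_bot (hz : IsZeroDimensionalFrame L) (h : cbd (⊥ : L) = ⊥) :
    IsAtomlessFrame L := by
  intro c hc hne
  have hex : ∃ a, IsComplemented a ∧ a ≤ c ∧ a ≠ ⊥ ∧ a ≠ c := by
    by_contra! hcon
    refine hne (le_bot_iff.1 (le_of_le_of_eq (le_sInf ?_) h))
    rintro x ⟨-, hx⟩
    by_contra hcx
    have h₁ : c ⊓ x = ⊥ := by
      rw [hz (c ⊓ x)]
      refine sSup_eq_bot.2 fun b ⟨hb, hbc⟩ => ?_
      by_contra hb0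
      exact hcx ((hcon b hbc (hb.trans inf_le_left) hb0).symm.le.trans (hb.trans inf_le_right))
    exact hne (le_bot_iff.1 (hx ▸ le_himp_iff.2 h₁.le))
  obtain ⟨a, ⟨a', ha⟩, hac, ha0, hne'⟩ := hex
  refine ⟨a, c ⊓ a', ⟨a', ha⟩, hc.inf ⟨a, ha.symm⟩, ha0, fun h0 => hne' (hac.antisymm ?_),
    ha.disjoint.mono_right inf_le_right, ?_⟩
  · exact ha.symm.disjoint_left_iff.1 (disjoint_iff.2 h0)
  · rw [sup_inf_left, ha.sup_eq_top, inf_top_eq, sup_eq_right.2 hac]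

end Frame

/-! ### Systems of balls -/

/-- The relations of the Cantor frame, with the ball `B_r(a)` of radius `r = p ^ (-n)` written as
`β a n`. -/
structure IsBallSystem (p : ℕ) {L : Type*} [Order.Frame L] (β : ℤ → ℕ → L) : Prop where
  disjoint : ∀ a b n m, ¬ (p : ℤ) ^ (n + 1) ∣ a - b → n ≤ m → Disjoint (β a n) (β b m)
  cover : sSup {x | ∃ a n, x = β a n} = ⊤
  interior : ∀ a n, β a n = sSup {x | ∃ b m, (p : ℤ) ^ (n + 1) ∣ a - b ∧ n < m ∧ x = β b m}

/-- A compact frame generated by a system of balls, with a point for every integer. -/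
structure IsCantorBase (p : ℕ) {L : Type*} [Order.Frame L] (β : ℤ → ℕ → L) : Prop
    extends IsBallSystem p β where
  compact : IsCompactFrame L
  generates : ∀ x, x ≤ sSup {y | y ≤ x ∧ ∃ a n, y = β a n}
  exists_point : ∀ z : ℤ, ∃ s, ∀ a n, β a n ≤ s ↔ ¬ (p : ℤ) ^ (n + 1) ∣ z - a

namespace IsBallSystem

variable {p : ℕ} {L : Type*} [Order.Frame L] {β : ℤ → ℕ → L}

/-- For distinct radii this is one term of the interior relation; for equal radii, every term of the
join for `b` is a term of the join for `a`. -/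
theorem le_of_dvd (h : IsBallSystem p β) {a b : ℤ} {n m : ℕ} (hab : (p : ℤ) ^ (n + 1) ∣ a - b)
    (hnm : n ≤ m) : β b m ≤ β a n := by
  rcases hnm.eq_or_lt with rfl | hlt
  · rw [h.interior b n, h.interior a n]
    refine sSup_le_sSup ?_
    rintro _ ⟨c, k, hc, hk, rfl⟩
    refine ⟨c, k, ?_, hk, rfl⟩
    have := dvd_add hab hc
    rwa [sub_add_sub_cancel] at this
  · rw [h.interior a n]
    exact le_sSup ⟨b, m, hab, hlt, rfl⟩

theorem anti (h : IsBallSystem p β) (a : ℤ) {n m : ℕ} (hnm : n ≤ m) : β a m ≤ β a n :=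
  h.le_of_dvd (by simp) hnm

theorem exists_dvd_sub (hp : 0 < p) {q c : ℤ} (hc : q ∣ c) :
    ∃ i ∈ Finset.range p, q * p ∣ q * (i : ℤ) - c := by
  have hp' : (0 : ℤ) < p := by exact_mod_cast hp
  obtain ⟨k, rfl⟩ := hc
  refine ⟨(k % p).toNat, ?_, ?_⟩
  · rw [Finset.mem_range]
    have := Int.emod_lt_of_pos k hp'
    have := Int.emod_nonneg k hp'.ne'
    omega
  · rw [Int.toNat_of_nonneg (Int.emod_nonneg k hp'.ne'), ← mul_sub]
    refine mul_dvd_mul_left q ?_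
    rw [← dvd_neg, neg_sub]
    exact Int.dvd_self_sub_emod

/-- Grouping the smaller balls by their next `p`-adic digit replaces the infinite join of the
interior relation by `p` terms. This finiteness is what makes the Cantor frame compact. -/
theorem le_sup_split (hp : 0 < p) (h : IsBallSystem p β) (a : ℤ) (n : ℕ) :
    β a n ≤ (Finset.range p).sup fun i => β (a + (p : ℤ) ^ (n + 1) * i) (n + 1) := by
  conv_lhs => rw [h.interior a n]
  refine sSup_le ?_
  rintro _ ⟨b, m, hab, hm, rfl⟩
  obtain ⟨i, hi, hd⟩ := exists_dvd_sub hp ((dvd_sub_comm).1 hab)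
  refine le_trans (h.le_of_dvd ?_ hm) (Finset.le_sup
    (f := fun i : ℕ => β (a + (p : ℤ) ^ (n + 1) * i) (n + 1)) hi)
  rw [pow_succ]
  convert hd using 1
  ring

theorem top_le_sup (hp : 0 < p) (h : IsBallSystem p β) :
    ⊤ ≤ (Finset.range p).sup fun i => β i 0 := by
  rw [← h.cover]
  refine sSup_le ?_
  rintro _ ⟨b, m, rfl⟩
  obtain ⟨i, hi, hd⟩ := exists_dvd_sub hp (one_dvd b)
  refine le_trans (h.le_of_dvd ?_ (Nat.zero_le m)) (Finset.le_sup
    (f := fun i : ℕ => β i 0) hi)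
  simpa using hd

theorem isFrameCover_range (hp : 0 < p) (h : IsBallSystem p β) (n : ℕ) :
    IsFrameCover (Set.range fun a => β a n) := by
  induction n with
  | zero =>
    exact top_le_iff.1 ((h.top_le_sup hp).trans (Finset.sup_le fun i _ => le_sSup ⟨i, rfl⟩))
  | succ n ih =>
    refine top_le_iff.1 (ih.ge.trans (sSup_le ?_))
    rintro _ ⟨a, rfl⟩
    exact (h.le_sup_split hp a n).trans (Finset.sup_le fun i _ => le_sSup ⟨_, rfl⟩)

theorem inf_eq (h : IsBallSystem p β) (a b : ℤ) (n m : ℕ) :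
    β a n ⊓ β b m = ⊥ ∨ ∃ c k, β a n ⊓ β b m = β c k := by
  wlog hnm : n ≤ m generalizing a b n m
  · rw [inf_comm]
    exact this b a m n (le_of_not_ge hnm)
  by_cases hd : (p : ℤ) ^ (n + 1) ∣ a - b
  · exact Or.inr ⟨b, m, inf_eq_right.2 (h.le_of_dvd hd hnm)⟩
  · exact Or.inl (h.disjoint a b n m hd hnm).eq_bot

/-- Two balls are nested or disjoint, so meets of balls reduce to balls; the empty meet uses the
cover relation. -/
theorem finset_inf_le_sSup (h : IsBallSystem p β) {ι : Type*} (F : Finset ι) (a : ι → ℤ)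
    (n : ι → ℕ) :
    (F.inf fun i => β (a i) (n i)) ≤
      sSup {y | y ≤ (F.inf fun i => β (a i) (n i)) ∧ ∃ a n, y = β a n} := by
  classical
  induction F using Finset.induction_on with
  | empty =>
    simp only [Finset.inf_empty, le_top, true_and]
    exact h.cover.ge
  | insert i F _ ih =>
    rw [Finset.inf_insert]
    refine (inf_le_inf_left _ ih).trans ?_
    rw [inf_sSup_eq]
    refine iSup₂_le ?_
    rintro _ ⟨hy, b, m, rfl⟩
    rcases h.inf_eq (a i) b (n i) m with h0 | ⟨c, k, hck⟩
    · rw [h0]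
      exact bot_le
    · exact le_sSup ⟨inf_le_inf_left _ hy, c, k, hck⟩

end IsBallSystem

/-! ### Zero-dimensionality, metrizability and the derivative from a base of balls -/

namespace IsCantorBase

variable {p : ℕ} {L : Type*} [Order.Frame L] {β : ℤ → ℕ → L}

theorem ball_ne_bot (h : IsCantorBase p β) (a : ℤ) (n : ℕ) : β a n ≠ ⊥ := by
  intro h0
  obtain ⟨s, hs⟩ := h.exists_point a
  exact (hs a n).1 (h0 ▸ bot_le) (by simp)

theorem le_of_forall_ball (h : IsCantorBase p β) {x y : L} (hxy : ∀ a n, β a n ≤ x → β a n ≤ y) :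
    x ≤ y := by
  refine (h.generates x).trans (sSup_le ?_)
  rintro _ ⟨hb, a, n, rfl⟩
  exact hxy a n hb

theorem nontrivial (h : IsCantorBase p β) : Nontrivial L :=
  ⟨β 0 0, ⊥, h.ball_ne_bot 0 0⟩

theorem isComplemented_ball (hp : 0 < p) (h : IsCantorBase p β) (a : ℤ) (n : ℕ) :
    IsComplemented (β a n) := by
  refine ⟨sSup {x | ∃ b, ¬ (p : ℤ) ^ (n + 1) ∣ a - b ∧ x = β b n}, ?_, ?_⟩
  · rw [disjoint_sSup_iff]
    rintro _ ⟨b, hb, rfl⟩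
    exact h.disjoint a b n n hb le_rfl
  · rw [codisjoint_iff_le_sup]
    refine (h.isFrameCover_range hp n).ge.trans (sSup_le ?_)
    rintro _ ⟨b, rfl⟩
    by_cases hd : (p : ℤ) ^ (n + 1) ∣ a - b
    · exact (h.le_of_dvd hd le_rfl).trans le_sup_left
    · exact le_sup_of_le_right (le_sSup ⟨b, hd, rfl⟩)

theorem isZeroDimensionalFrame (hp : 0 < p) (h : IsCantorBase p β) :
    IsZeroDimensionalFrame L := fun _ =>
  le_antisymm (h.le_of_forall_ball fun a n hb => le_sSup ⟨hb, h.isComplemented_ball hp a n⟩)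
    (sSup_le fun _ hb => hb.1)

/-- Balls of the same radius coincide or are disjoint, so each partition into balls is its own
star-refinement. -/
theorem coverStar_range_le (h : IsCantorBase p β) (a : ℤ) (n : ℕ) :
    coverStar (Set.range fun a => β a n) (β a n) ≤ β a n := by
  refine sSup_le ?_
  rintro _ ⟨⟨b, rfl⟩, hb⟩
  by_cases hd : (p : ℤ) ^ (n + 1) ∣ a - b
  · exact h.le_of_dvd hd le_rfl
  · refine absurd (h.disjoint b a n n ?_ le_rfl).eq_bot hb
    rwa [dvd_sub_comm]

/-- The uniformity generated by the partitions into balls of a fixed radius. -/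
def uniformity (hp : 0 < p) (h : IsCantorBase p β) : FrameUniformity L where
  covers := {A | ∃ n, CoverRefines (Set.range fun a => β a n) A}
  isCover := fun _ ⟨n, hn⟩ => hn.isFrameCover (h.isFrameCover_range hp n)
  nonempty := ⟨Set.range fun a => β a 0, 0, fun x hx => ⟨x, hx, le_rfl⟩⟩
  upward := fun _ ⟨n, hn⟩ _ _ hAB => ⟨n, fun x hx =>
    let ⟨a, ha, hxa⟩ := hn x hx
    let ⟨b, hb, hab⟩ := hAB a ha
    ⟨b, hb, hxa.trans hab⟩⟩
  inf_mem := by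
    rintro A ⟨n, hn⟩ B ⟨m, hm⟩
    refine ⟨max n m, ?_⟩
    rintro _ ⟨c, rfl⟩
    obtain ⟨a, ha, hca⟩ := hn _ ⟨c, rfl⟩
    obtain ⟨b, hb, hcb⟩ := hm _ ⟨c, rfl⟩
    exact ⟨a ⊓ b, ⟨a, ha, b, hb, rfl⟩, le_inf ((h.anti c (le_max_left n m)).trans hca)
      ((h.anti c (le_max_right n m)).trans hcb)⟩
  star_refine := by
    rintro A ⟨n, hn⟩
    refine ⟨Set.range fun a => β a n, ⟨n, fun x hx => ⟨x, hx, le_rfl⟩⟩, ?_⟩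
    rintro _ ⟨_, ⟨c, rfl⟩, rfl⟩
    obtain ⟨a, ha, hca⟩ := hn _ ⟨c, rfl⟩
    exact ⟨a, ha, (h.coverStar_range_le c n).trans hca⟩
  admissible := fun x => by
    apply le_antisymm
    · refine h.le_of_forall_ball fun a n hb => le_sSup ?_
      exact ⟨Set.range fun a => β a n, ⟨n, fun x hx => ⟨x, hx, le_rfl⟩⟩,
        (h.coverStar_range_le a n).trans hb⟩
    · refine sSup_le ?_
      rintro y ⟨A, ⟨n, hn⟩, hy⟩
      exact ((hn.isFrameCover (h.isFrameCover_range hp n)).le_coverStar y).trans hy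

theorem isMetrizableFrame (hp : 0 < p) (h : IsCantorBase p β) : IsMetrizableFrame L := by
  refine ⟨h.uniformity hp, Set.range fun n => Set.range fun a => β a n, Set.countable_range _, ?_,
    ?_⟩
  · rintro _ ⟨n, rfl⟩
    exact ⟨n, fun x hx => ⟨x, hx, le_rfl⟩⟩
  · rintro A ⟨n, hn⟩
    exact ⟨_, ⟨n, rfl⟩, hn⟩

/-- `s z` is the complement of the point `z`. It is dense because every ball contains a smaller ball
missing `z`, whereas a ball is never below the `s` of its own centre. -/
theorem cbd_bot (hp : 1 < p) (h : IsCantorBase p β) : cbd (⊥ : L) = ⊥ := by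
  choose s hs using h.exists_point
  have hdense : ∀ z, s z ⇨ ⊥ = ⊥ := by
    intro z
    refine le_bot_iff.1 (h.le_of_forall_ball fun a n hb => ?_)
    -- Shifting the centre by `p ^ (n + 1)` changes the next digit, so `a` or its shift avoids `z`.
    have hex : ∃ b, (p : ℤ) ^ (n + 1) ∣ a - b ∧ ¬ (p : ℤ) ^ (n + 1 + 1) ∣ z - b := by
      by_cases hd : (p : ℤ) ^ (n + 1 + 1) ∣ z - a
      · refine ⟨a + (p : ℤ) ^ (n + 1), by simp, fun hd' => ?_⟩
        have h₁ := dvd_sub hd hd'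
        rw [sub_sub_sub_cancel_left, add_sub_cancel_left] at h₁
        have h₂ : p ^ (n + 1 + 1) ∣ p ^ (n + 1) := by exact_mod_cast h₁
        exact absurd ((Nat.pow_dvd_pow_iff_le_right hp).1 h₂) (by omega)
      · exact ⟨a, by simp, hd⟩
    obtain ⟨b, hab, hbz⟩ := hex
    have h₁ : β b (n + 1) ≤ s z ⇨ ⊥ := (h.le_of_dvd hab n.le_succ).trans hb
    have h₂ : β b (n + 1) ≤ s z := (hs z b (n + 1)).2 hbz
    exact absurd (le_bot_iff.1 ((le_inf le_rfl h₂).trans (le_himp_iff.1 h₁))) (h.ball_ne_bot b _)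
  refine le_bot_iff.1 (h.le_of_forall_ball fun a n hb => ?_)
  have h₁ : β a n ≤ s a := hb.trans (sInf_le ⟨bot_le, hdense a⟩)
  exact absurd (by simp) ((hs a a n).1 h₁)

/-- Transport along an isomorphism of frames. -/
theorem map (h : IsCantorBase p β) {L' : Type*} [Order.Frame L'] (e : L ≃o L') :
    IsCantorBase p fun a n => e (β a n) where
  disjoint a b n m hd hnm := (h.disjoint a b n m hd hnm).map_orderIso e
  cover := by
    rw [← map_top e, ← h.cover, e.map_sSup, ← sSup_image]
    congr 1
    ext x
    simp only [Set.mem_ofPred_eq, Set.mem_image]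
    constructor
    · rintro ⟨a, n, rfl⟩
      exact ⟨_, ⟨a, n, rfl⟩, rfl⟩
    · rintro ⟨_, ⟨a, n, rfl⟩, rfl⟩
      exact ⟨a, n, rfl⟩
  interior a n := by
    rw [h.interior a n, e.map_sSup, ← sSup_image]
    congr 1
    ext x
    simp only [Set.mem_ofPred_eq, Set.mem_image]
    constructor
    · rintro ⟨_, ⟨b, m, h₁, h₂, rfl⟩, rfl⟩
      exact ⟨b, m, h₁, h₂, rfl⟩
    · rintro ⟨b, m, h₁, h₂, rfl⟩
      exact ⟨_, ⟨b, m, h₁, h₂, rfl⟩, rfl⟩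
  compact := by
    classical
    refine (CompleteLattice.isCompactElement_iff_exists_le_sSup_of_le_sSup L' ⊤).2
      fun S hS => ?_
    have h₁ : (⊤ : L) ≤ sSup (e ⁻¹' S) := by
      rw [← e.le_iff_le, e.map_sSup, ← sSup_image, e.image_preimage, map_top]
      exact hS
    obtain ⟨T, hT, hle⟩ :=
      (CompleteLattice.isCompactElement_iff_exists_le_sSup_of_le_sSup L ⊤).1 h.compact _ h₁
    refine ⟨T.image e, ?_, ?_⟩
    · rw [Finset.coe_image, Set.image_subset_iff]
      exact hT
    · rw [← e.le_iff_le, map_finset_sup, map_top] at hle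
      rw [Finset.sup_image]
      exact hle
  generates x := by
    rw [← e.symm.le_iff_le]
    refine (h.generates _).trans (sSup_le ?_)
    rintro _ ⟨hb, a, n, rfl⟩
    rw [← e.le_iff_le, e.apply_symm_apply]
    exact le_sSup ⟨(e.le_symm_apply).1 hb, a, n, rfl⟩
  exists_point z := by
    obtain ⟨s, hs⟩ := h.exists_point z
    exact ⟨e s, fun a n => by rw [e.le_iff_le, hs]⟩

end IsCantorBase

/-! ### The Cantor frame is generated by a system of balls -/

section FreeFrame

variable {G : Type*}

theorem FreeFrame.mem_gen {g : G} {F : Finset G} :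
    OrderDual.toDual F ∈ FreeFrame.gen g ↔ g ∈ F := by
  rw [FreeFrame.gen, LowerSet.mem_Iic_iff, OrderDual.toDual_le_toDual]
  exact Finset.singleton_subset_iff

theorem FreeFrame.mem_of_subset {s : FreeFrame G} {F F' : Finset G}
    (h : OrderDual.toDual F ∈ s) (hF : F ⊆ F') : OrderDual.toDual F' ∈ s :=
  s.lower (OrderDual.toDual_le_toDual.2 hF) h

/-- A down-set is closed under enlarging the finite set, so meeting with a generator amounts to
inserting it. -/
theorem FreeFrame.gen_inf_le_iff [DecidableEq G] {g : G} {c s : FreeFrame G} :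
    FreeFrame.gen g ⊓ c ≤ s ↔
      ∀ F : Finset G, OrderDual.toDual F ∈ c → OrderDual.toDual (insert g F) ∈ s := by
  constructor
  · intro h F hF
    exact h ⟨FreeFrame.mem_gen.2 (Finset.mem_insert_self g F),
      FreeFrame.mem_of_subset hF (Finset.subset_insert g F)⟩
  · rintro h F ⟨hg, hc⟩
    have := h (OrderDual.ofDual F) hc
    have hg' : g ∈ OrderDual.ofDual F := FreeFrame.mem_gen.1 hg
    rwa [Finset.insert_eq_of_mem hg'] at this

theorem FreeFrame.Iic_eq_inf (F : Finset G) :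
    (LowerSet.Iic (OrderDual.toDual F) : FreeFrame G) = F.inf FreeFrame.gen := by
  refine le_antisymm (Finset.le_inf fun g hg => LowerSet.Iic_le.2 (FreeFrame.mem_gen.2 hg)) ?_
  intro F' hF'
  exact LowerSet.mem_Iic_iff.2 fun g hg => FreeFrame.mem_gen.1 (Finset.inf_le (f := gen) hg hF')

theorem FreeFrame.le_sSup_inf (s : FreeFrame G) :
    s ≤ sSup {x | ∃ F : Finset G, OrderDual.toDual F ∈ s ∧ x = F.inf FreeFrame.gen} := by
  intro F hF
  refine LowerSet.mem_sSup_iff.2 ⟨_, ⟨OrderDual.ofDual F, hF, rfl⟩, ?_⟩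
  rw [← FreeFrame.Iic_eq_inf]
  exact LowerSet.mem_Iic_iff.2 le_rfl

end FreeFrame

section PresentedFrame

variable {G : Type*} {R : FreeFrame G → FreeFrame G → Prop}

/-- `restrict` is left adjoint to the inclusion, and saturation with `c = ⊤` gives both images the
same upper bounds. -/
theorem PresentedFrame.restrict_eq_of_rel {u v : FreeFrame G} (h : R u v) :
    (Sublocale.saturated R).restrict u = (Sublocale.saturated R).restrict v := by
  refine eq_of_forall_ge_iff fun s => ?_
  rw [(Sublocale.saturated R).giRestrict.gc.le_iff_le,
    (Sublocale.saturated R).giRestrict.gc.le_iff_le]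
  simpa only [inf_top_eq] using s.2 u v h ⊤

/-- Every element of a presented frame is a join of finite meets of generators. -/
theorem PresentedFrame.le_sSup_inf (x : PresentedFrame R) :
    x ≤ sSup {y | y ≤ x ∧ ∃ F : Finset G,
      y = F.inf fun g => (Sublocale.saturated R).restrict (FreeFrame.gen g)} := by
  have hx : x = (Sublocale.saturated R).restrict x.1 :=
    ((Sublocale.saturated R).giRestrict.l_u_eq x).symm
  conv_lhs => rw [hx]
  refine (OrderHomClass.mono _ (FreeFrame.le_sSup_inf x.1)).trans ?_
  rw [map_sSup]
  refine sSup_le ?_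
  rintro _ ⟨_, ⟨F, hF, rfl⟩, rfl⟩
  refine le_sSup ⟨?_, F, map_finset_inf _ _ _⟩
  rw [(Sublocale.saturated R).giRestrict.gc.le_iff_le, ← FreeFrame.Iic_eq_inf]
  exact LowerSet.Iic_le.2 hF

end PresentedFrame

/-! ### Radii as powers of `p`, and distance as divisibility -/

section Radii

variable {p : ℕ}

/-- The radius `p ^ (-n)`. -/
def cantorRadius (p n : ℕ) : cantorRadii p :=
  ⟨(p : ℚ) ^ (-(n : ℤ)), n + 1, by omega, by push_cast; ring_nf⟩

theorem cantorRadius_surjective (r : cantorRadii p) : ∃ n, r = cantorRadius p n := by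
  obtain ⟨_, n, hn, rfl⟩ := r
  refine ⟨n - 1, Subtype.ext ?_⟩
  simp only [cantorRadius]
  congr 1
  omega

variable [hp : Fact p.Prime]

theorem cantorRadius_le_iff {n m : ℕ} :
    (cantorRadius p n : ℚ) ≤ (cantorRadius p m : ℚ) ↔ m ≤ n := by
  have h1 : (1 : ℚ) < p := by exact_mod_cast hp.out.one_lt
  simp only [cantorRadius]
  rw [zpow_le_zpow_iff_right₀ h1]
  omega

theorem cantorRadius_lt_iff {n m : ℕ} :
    (cantorRadius p n : ℚ) < (cantorRadius p m : ℚ) ↔ m < n := by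
  rw [← not_le, cantorRadius_le_iff, not_le]

/-- Nonzero norms are integer powers of `p`, so being below `p ^ (-n)` means being at most `p ^ (-(n
+ 1))`; hence the exponent `n + 1`. -/
theorem padicNorm_sub_lt_cantorRadius_iff {a b : ℤ} {n : ℕ} :
    padicNorm p ((a : ℚ) - (b : ℚ)) < (cantorRadius p n : ℚ) ↔ (p : ℤ) ^ (n + 1) ∣ a - b := by
  have h1 : (1 : ℚ) < p := by exact_mod_cast hp.out.one_lt
  have hdvd := padicNorm.dvd_iff_norm_le (p := p) (n := n + 1) (z := a - b)
  push_cast at hdvd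
  rw [hdvd]
  simp only [cantorRadius]
  by_cases h0 : (a : ℚ) - b = 0
  · rw [h0, padicNorm.zero]
    constructor <;> intro <;> positivity
  · obtain ⟨k, hk⟩ := padicNorm.values_discrete (p := p) h0
    rw [hk, zpow_lt_zpow_iff_right₀ h1, zpow_le_zpow_iff_right₀ h1]
    omega

end Radii

/-! ### Balls, points and compactness of the Cantor frame -/

section CantorFrame

variable {p : ℕ}

/-- The ball `B_r(a)` in the Cantor frame. -/
def cantorBall (p : ℕ) (g : ℤ × cantorRadii p) : CantorFrame p :=
  (Sublocale.saturated (CantorRel p)).restrict (FreeFrame.gen g)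

/-- A criterion for a down-set of finite sets of formal balls to define an element of the Cantor
frame. -/
theorem mem_saturated_cantorRel {s : FreeFrame (ℤ × cantorRadii p)}
    (hdisj : ∀ (a b : ℤ) (r t : cantorRadii p), (r : ℚ) ≤ padicNorm p ((a : ℚ) - (b : ℚ)) →
      (t : ℚ) ≤ (r : ℚ) → ∀ F : Finset (ℤ × cantorRadii p), (a, r) ∈ F → (b, t) ∈ F →
        OrderDual.toDual F ∈ s)
    (hcover : ∀ F : Finset (ℤ × cantorRadii p),
      (∀ g, OrderDual.toDual (insert g F) ∈ s) → OrderDual.toDual F ∈ s)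
    (hint : ∀ (a : ℤ) (r : cantorRadii p) (F : Finset (ℤ × cantorRadii p)),
      OrderDual.toDual (insert (a, r) F) ∈ s ↔ ∀ (b : ℤ) (t : cantorRadii p),
        padicNorm p ((a : ℚ) - (b : ℚ)) < (r : ℚ) → (t : ℚ) < (r : ℚ) →
          OrderDual.toDual (insert (b, t) F) ∈ s) :
    s ∈ Sublocale.saturated (CantorRel p) := by
  intro u v huv c
  cases huv with
  | disjoint a b r t hab hsr =>
    refine iff_of_true ?_ (by simp)
    rintro F ⟨⟨h₁, h₂⟩, -⟩
    exact hdisj a b r t hab hsr (OrderDual.ofDual F) (FreeFrame.mem_gen.1 h₁)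
      (FreeFrame.mem_gen.1 h₂)
  | cover =>
    rw [top_inf_eq, sSup_inf_eq, iSup₂_le_iff]
    constructor
    · rintro h _ -
      exact inf_le_right.trans h
    · intro h F hF
      refine hcover (OrderDual.ofDual F) fun g => ?_
      exact FreeFrame.gen_inf_le_iff.1 (h (formalBall p g.1 g.2) ⟨g.1, g.2, rfl⟩) _ hF
  | interior a r =>
    rw [sSup_inf_eq, iSup₂_le_iff, formalBall, FreeFrame.gen_inf_le_iff]
    constructor
    · rintro h _ ⟨b, t, h₁, h₂, rfl⟩
      exact FreeFrame.gen_inf_le_iff.2 fun F hF => (hint a r F).1 (h F hF) b t h₁ h₂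
    · intro h F hF
      refine (hint a r F).2 fun b t h₁ h₂ => ?_
      exact FreeFrame.gen_inf_le_iff.1 (h _ ⟨b, t, h₁, h₂, rfl⟩) F hF

theorem cantorBall_le_iff {g : ℤ × cantorRadii p} {s : CantorFrame p} :
    cantorBall p g ≤ s ↔ OrderDual.toDual {g} ∈ s.1 := by
  rw [cantorBall, (Sublocale.saturated (CantorRel p)).giRestrict.gc.le_iff_le]
  exact LowerSet.Iic_le

variable [hp : Fact p.Prime]

theorem isBallSystem_cantorBall :
    IsBallSystem p fun a n => cantorBall p (a, cantorRadius p n) where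
  disjoint a b n m hd hnm := by
    rw [disjoint_iff, cantorBall, cantorBall, ← map_inf]
    rw [← padicNorm_sub_lt_cantorRadius_iff, not_lt] at hd
    exact (PresentedFrame.restrict_eq_of_rel
      (CantorRel.disjoint a b _ _ hd (cantorRadius_le_iff.2 hnm))).trans (map_bot _)
  cover := by
    have h := PresentedFrame.restrict_eq_of_rel (CantorRel.cover (p := p))
    rw [map_top, map_sSup] at h
    rw [h]
    congr 1
    ext x
    constructor
    · rintro ⟨a, n, rfl⟩
      exact ⟨_, ⟨a, _, rfl⟩, rfl⟩
    · rintro ⟨_, ⟨a, r, rfl⟩, rfl⟩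
      obtain ⟨n, rfl⟩ := cantorRadius_surjective r
      exact ⟨a, n, rfl⟩
  interior a n := by
    have h := PresentedFrame.restrict_eq_of_rel (CantorRel.interior a (cantorRadius p n))
    rw [map_sSup] at h
    refine Eq.trans h ?_
    congr 1
    ext x
    constructor
    · rintro ⟨_, ⟨b, t, h₁, h₂, rfl⟩, rfl⟩
      obtain ⟨m, rfl⟩ := cantorRadius_surjective t
      exact ⟨b, m, padicNorm_sub_lt_cantorRadius_iff.1 h₁, cantorRadius_lt_iff.1 h₂, rfl⟩
    · rintro ⟨b, m, h₁, h₂, rfl⟩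
      exact ⟨_, ⟨b, _, padicNorm_sub_lt_cantorRadius_iff.2 h₁, cantorRadius_lt_iff.2 h₂, rfl⟩, rfl⟩

/-- The point of the Cantor frame given by the integer `z`: the largest element to which `z` does
not belong. -/
def cantorPoint (p : ℕ) [hp : Fact p.Prime] (z : ℤ) : CantorFrame p where
  val := {
    carrier := {F | ∃ g ∈ OrderDual.ofDual F, g.2 ≤ padicNorm p ((z : ℚ) - (g.1 : ℚ))}
    lower' := fun _ _ hF ⟨g, hg, h⟩ => ⟨g, hF hg, h⟩ }
  property := by
    refine mem_saturated_cantorRel ?_ ?_ ?_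
    · intro a b r t hab htr F ha hb
      by_contra hcon
      have h' : ∀ g ∈ F, padicNorm p ((z : ℚ) - (g.1 : ℚ)) < g.2 := fun g hg =>
        not_le.1 fun h => hcon ⟨g, hg, h⟩
      have h₁ := h' _ ha
      have h₂ := (h' _ hb).trans_le htr
      refine absurd hab (not_le.2 ?_)
      have h₃ := padicNorm.sub (p := p) (q := (z : ℚ) - b) (r := (z : ℚ) - a)
      rw [sub_sub_sub_cancel_left] at h₃
      exact h₃.trans_lt (max_lt h₂ h₁)
    · intro F h
      -- The tested ball contains `z`, so the ball missing `z` must already belong to `F`.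
      obtain ⟨g, hg, hz⟩ := h (z, cantorRadius p 0)
      rcases Finset.mem_insert.1 hg with rfl | hg
      · have h₁ : padicNorm p ((z : ℚ) - (z : ℚ)) < (cantorRadius p 0 : ℚ) :=
          padicNorm_sub_lt_cantorRadius_iff.2 (by simp)
        exact absurd h₁ (not_lt.2 hz)
      · exact ⟨g, hg, hz⟩
    · intro a r F
      obtain ⟨n, rfl⟩ := cantorRadius_surjective r
      constructor
      · rintro ⟨g, hg, hz⟩ b t hab ht
        rcases Finset.mem_insert.1 hg with rfl | hg
        · refine ⟨(b, t), Finset.mem_insert_self _ _, ?_⟩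
          by_contra! hcon
          refine absurd hz (not_le.2 ?_)
          have h₃ := padicNorm.sub (p := p) (q := (z : ℚ) - b) (r := (a : ℚ) - b)
          rw [sub_sub_sub_cancel_right] at h₃
          exact h₃.trans_lt (max_lt (hcon.trans ht) hab)
        · exact ⟨g, Finset.mem_insert_of_mem hg, hz⟩
      · intro h
        -- If `z` lies in the ball, the next smaller ball around `z` is an admissible test;
        -- otherwise the ball itself misses `z`.
        by_cases hz : padicNorm p ((a : ℚ) - (z : ℚ)) < (cantorRadius p n : ℚ)
        · obtain ⟨g, hg, hzg⟩ := h z (cantorRadius p (n + 1)) hz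
            (cantorRadius_lt_iff.2 n.lt_succ_self)
          rcases Finset.mem_insert.1 hg with rfl | hg
          · have h₁ : padicNorm p ((z : ℚ) - (z : ℚ)) < (cantorRadius p (n + 1) : ℚ) :=
              padicNorm_sub_lt_cantorRadius_iff.2 (by simp)
            exact absurd h₁ (not_lt.2 hzg)
          · exact ⟨g, Finset.mem_insert_of_mem hg, hzg⟩
        · refine ⟨(a, cantorRadius p n), Finset.mem_insert_self _ _, ?_⟩
          rw [padicNorm_sub_lt_cantorRadius_iff, dvd_sub_comm,
            ← padicNorm_sub_lt_cantorRadius_iff] at hz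
          exact not_lt.1 hz

/-- For a directed `D` with join `⊤`, the finite sets of balls whose meet is below a member of `D`
form a saturated down-set: the cover and interior relations reduce to `p` balls, and directedness
bounds finitely many members of `D`. This element is above all of `D`, so it is `⊤`. -/
theorem isCompactFrame_cantorFrame : IsCompactFrame (CantorFrame p) := by
  refine (CompleteLattice.isCompactElement_iff_le_of_directed_sSup_le _ ⊤).2 fun D hne hD htop => ?_
  have hβ := isBallSystem_cantorBall (p := p)
  have hsup : ∀ (x : CantorFrame p) (f : ℕ → CantorFrame p) (T : Finset ℕ),
      (∀ i ∈ T, ∃ d ∈ D, f i ⊓ x ≤ d) → ∃ d ∈ D, T.sup f ⊓ x ≤ d := by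
    intro x f T hT
    rw [Finset.sup_inf_distrib_right]
    induction T using Finset.induction_on with
    | empty =>
      obtain ⟨d, hd⟩ := hne
      exact ⟨d, hd, by simp⟩
    | insert i T _ ih =>
      rw [Finset.forall_mem_insert] at hT
      obtain ⟨d, hd, hid⟩ := hT.1
      obtain ⟨d', hd', hTd⟩ := ih hT.2
      obtain ⟨d'', hd'', h₁, h₂⟩ := hD d hd d' hd'
      refine ⟨d'', hd'', ?_⟩
      rw [Finset.sup_insert]
      exact sup_le (hid.trans h₁) (hTd.trans h₂)
  let s : FreeFrame (ℤ × cantorRadii p) :=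
    { carrier := {F | ∃ d ∈ D, (OrderDual.ofDual F).inf (cantorBall p) ≤ d}
      lower' := fun F F' hF ⟨d, hd, h⟩ => ⟨d, hd, (Finset.inf_mono hF).trans h⟩ }
  have hs : s ∈ Sublocale.saturated (CantorRel p) := by
    refine mem_saturated_cantorRel ?_ ?_ ?_
    · intro a b r t hab htr F ha hb
      obtain ⟨n, rfl⟩ := cantorRadius_surjective r
      obtain ⟨m, rfl⟩ := cantorRadius_surjective t
      obtain ⟨d, hd⟩ := hne
      refine ⟨d, hd, ?_⟩
      have hdis : Disjoint (cantorBall p (a, cantorRadius p n)) (cantorBall p (b, cantorRadius p m)) :=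
        hβ.disjoint a b n m (by rwa [← padicNorm_sub_lt_cantorRadius_iff, not_lt])
          (cantorRadius_le_iff.1 htr)
      exact (hdis (Finset.inf_le ha) (Finset.inf_le hb)).trans bot_le
    · intro F h
      obtain ⟨d, hd, hle⟩ := hsup (F.inf (cantorBall p)) (fun i => cantorBall p (i, cantorRadius p 0))
        (Finset.range p) fun i _ => by
          obtain ⟨d, hd, hle⟩ := h ((i : ℤ), cantorRadius p 0)
          exact ⟨d, hd, by rwa [OrderDual.ofDual_toDual, Finset.inf_insert] at hle⟩
      exact ⟨d, hd, (le_inf (le_top.trans (hβ.top_le_sup hp.out.pos)) le_rfl).trans hle⟩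
    · intro a r F
      obtain ⟨n, rfl⟩ := cantorRadius_surjective r
      constructor
      · rintro ⟨d, hd, hle⟩ b t hab ht
        obtain ⟨m, rfl⟩ := cantorRadius_surjective t
        refine ⟨d, hd, le_trans ?_ hle⟩
        rw [OrderDual.ofDual_toDual, OrderDual.ofDual_toDual, Finset.inf_insert, Finset.inf_insert]
        exact inf_le_inf_right _ (hβ.le_of_dvd (padicNorm_sub_lt_cantorRadius_iff.1 hab)
          (cantorRadius_lt_iff.1 ht).le)
      · intro h
        obtain ⟨d, hd, hle⟩ := hsup (F.inf (cantorBall p))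
          (fun i => cantorBall p (a + (p : ℤ) ^ (n + 1) * i, cantorRadius p (n + 1)))
          (Finset.range p) fun i _ => by
            obtain ⟨d, hd, hle⟩ := h (a + (p : ℤ) ^ (n + 1) * i) (cantorRadius p (n + 1))
              (padicNorm_sub_lt_cantorRadius_iff.2 (by simp))
              (cantorRadius_lt_iff.2 n.lt_succ_self)
            exact ⟨d, hd, by rwa [OrderDual.ofDual_toDual, Finset.inf_insert] at hle⟩
        refine ⟨d, hd, le_trans ?_ hle⟩
        rw [OrderDual.ofDual_toDual, Finset.inf_insert]
        exact inf_le_inf_right _ (hβ.le_sup_split hp.out.pos a n)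
  have htops : (⊤ : CantorFrame p) ≤ ⟨s, hs⟩ := by
    refine htop.trans (sSup_le fun d hd => ?_)
    intro F hF
    refine ⟨d, hd, ?_⟩
    have h := map_finset_inf (Sublocale.saturated (CantorRel p)).restrict (OrderDual.ofDual F)
      FreeFrame.gen
    refine h.symm.le.trans ?_
    rw [(Sublocale.saturated (CantorRel p)).giRestrict.gc.le_iff_le, ← FreeFrame.Iic_eq_inf]
    exact LowerSet.Iic_le.2 hF
  -- The empty meet is `⊤`, so membership of `∅` puts `⊤` below a member of `D`.
  obtain ⟨d, hd, hle⟩ : OrderDual.toDual (∅ : Finset (ℤ × cantorRadii p)) ∈ s :=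
    htops (show OrderDual.toDual (∅ : Finset (ℤ × cantorRadii p)) ∈
      (⊤ : FreeFrame (ℤ × cantorRadii p)) from trivial)
  exact ⟨d, hd, hle⟩

theorem isCantorBase_cantorBall :
    IsCantorBase p fun a n => cantorBall p (a, cantorRadius p n) where
  toIsBallSystem := isBallSystem_cantorBall
  compact := isCompactFrame_cantorFrame
  generates x := by
    refine (PresentedFrame.le_sSup_inf x).trans (sSup_le ?_)
    rintro _ ⟨hF, F, rfl⟩
    choose n hn using cantorRadius_surjective (p := p)
    have hFn : (F.inf fun g => (Sublocale.saturated (CantorRel p)).restrict (FreeFrame.gen g)) =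
        F.inf fun g => cantorBall p (g.1, cantorRadius p (n g.2)) :=
      Finset.inf_congr rfl fun g _ => by rw [← hn g.2]; rfl
    rw [hFn] at hF ⊢
    refine ((isBallSystem_cantorBall (p := p)).finset_inf_le_sSup F (fun g => g.1)
      fun g => n g.2).trans (sSup_le_sSup ?_)
    rintro _ ⟨hy, a, m, rfl⟩
    exact ⟨hy.trans hF, a, m, rfl⟩
  exists_point z := by
    refine ⟨cantorPoint p z, fun a n => ?_⟩
    rw [cantorBall_le_iff, ← padicNorm_sub_lt_cantorRadius_iff, not_lt]
    constructor
    · rintro ⟨g, hg, h⟩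
      rwa [Finset.mem_singleton.1 hg] at h
    · intro h
      exact ⟨_, Finset.mem_singleton_self _, h⟩

end CantorFrame

/-- The Cantor frame is, up to isomorphism, the only nontrivial zero-dimensional compact metrizable
frame with trivial Cantor–Bendixson derivative of the bottom element. -/
theorem theorem3 (p : ℕ) [Fact p.Prime] (L : Type*) [Order.Frame L] :
    Nonempty (L ≃o CantorFrame p) ↔
      (Nontrivial L ∧ IsZeroDimensionalFrame L ∧ IsCompactFrame L ∧ IsMetrizableFrame L ∧
        cbd (⊥ : L) = ⊥) := by
  have hp : p.Prime := Fact.out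
  have hC := isCantorBase_cantorBall (p := p)
  constructor
  · rintro ⟨e⟩
    have h := hC.map e.symm
    exact ⟨h.nontrivial, h.isZeroDimensionalFrame hp.pos, h.compact, h.isMetrizableFrame hp.pos,
      h.cbd_bot hp.one_lt⟩
  · rintro ⟨hn, hz, hc, hm, hcbd⟩
    have := hC.nontrivial
    have hz' := hC.isZeroDimensionalFrame hp.pos
    exact nonempty_orderIso_of_countable_atomless hz hz' hc hC.compact
      (countable_isComplemented hc hm)
      (countable_isComplemented hC.compact (hC.isMetrizableFrame hp.pos))
      (isAtomlessFrame_of_cbd_bot hz hcbd) (isAtomlessFrame_of_cbd_bot hz' (hC.cbd_bot hp.one_lt))
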